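/- Let $K$ be a commutative field and let $\mathbb{P}_3(K)$ be the projective space whose points are the one-dimensional subspaces $K(p_0,p_1,p_2,p_3)^{T}$ of $K^{4\times 1}$. A collineation is a bijection of the point set that maps lines onto lines; a projective collineation is a map $K\mathbf p\mapsto K(M\cdot\mathbf p)$ with $M\in \mathrm{GL}_4(K)$. Let $$F=\{K(p_0,p_1,p_2,p_3)^{T}\mid p_0p_1p_2-p_1^3-p_0^2p_3=0\}$$ be Cayley's ruled cubic surface, let $Q_0=K(1,0,0,0)^{T}$, and let $G(F)$ be the group of all matrices $$M_{a,b,c}=\begin{pmatrix}1&0&0&0\\ a&c&0&0\\ b&3ac&c^2&0\\ ab-a^3&bc&ac^2&c^3\end{pmatrix},\qquad a,b\in K,\ c\in K\setminus\{0\}.$$ **Proposition.** Each collineation $\kappa$ of $\mathbb{P}_3(K)$ which fixes $F$ (as a set, i.e. $\kappa(F)=F$) can be written as $\kappa=\kappa_3\circ\kappa_2\circ\kappa_1$, where 1. $\kappa_1$ is the collineation $K(p_0,p_1,p_2,p_3)^{T}\mapsto K(\zeta(p_0),\zeta(p_1),\zeta(p_2),\zeta(p_3))^{T}$ for some automorphism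 $\zeta\in\mathrm{Aut}(K)$, 2. $\kappa_2$ is a projective collineation with $\kappa_2(F)=F$ and $\kappa_2(Q_0)=Q_0$, 3. $\kappa_3$ is induced by a matrix in $G(F)$. Conversely, every such composition $\kappa_3\circ\kappa_2\circ\kappa_1$ is a collineation of $\mathbb{P}_3(K)$ which fixes $F$. Thus the collineations fixing $F$ are determined, in terms of the stabilizer of $Q_0$ in the group of projective collineations fixing $F$, as exactly these compositions. -/

import Mathlib

open scoped LinearAlgebra.Projectivization

namespace CayleySurface

section

variable (K : Type*) [Field K]

/-- Points of the three-dimensional projective space over `K`: the one-dimensional subspaces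
of the space of column vectors of length four. -/
abbrev Point : Type _ := ℙ K (Fin 4 → K)

variable {K}

/-- The projective lines, regarded as sets of points: each consists of all points contained in
some two-dimensional subspace. -/
def IsLine (L : Set (Point K)) : Prop :=
  ∃ W : Submodule K (Fin 4 → K), Module.finrank K W = 2 ∧ L = {P : Point K | P.submodule ≤ W}

/-- A collineation is a bijection of the set of points which maps lines onto lines. -/
def IsCollineation (κ : Point K → Point K) : Prop :=
  Function.Bijective κ ∧ ∀ L : Set (Point K), IsLine L → IsLine (κ '' L)

/-- The set of `K`-rational points of the variety given by a form `g`. -/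
def zeroSet (g : MvPolynomial (Fin 4) K) : Set (Point K) :=
  {P | ∀ p ∈ P.submodule, MvPolynomial.eval p g = 0}

variable (K)

/-- The cubic form `X₀X₁X₂ - X₁³ - X₀²X₃`. -/
noncomputable def cayleyForm : MvPolynomial (Fin 4) K :=
  MvPolynomial.X 0 * MvPolynomial.X 1 * MvPolynomial.X 2 - MvPolynomial.X 1 ^ 3
    - MvPolynomial.X 0 ^ 2 * MvPolynomial.X 3

/-- Cayley's ruled cubic surface, as a set of points. -/
noncomputable def cayleySurface : Set (Point K) := zeroSet (cayleyForm K)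

/-- The base point `Q₀ = K(1,0,0,0)ᵀ`. -/
def Q₀ : Point K :=
  Projectivization.mk K (![1, 0, 0, 0] : Fin 4 → K) (fun h => one_ne_zero (congrFun h 0))

variable {K}

/-- The coordinatewise application of a field automorphism, as a semilinear map. -/
def coordMap (ζ : K ≃+* K) : (Fin 4 → K) →ₛₗ[(ζ : K →+* K)] (Fin 4 → K) where
  toFun p := fun i => ζ (p i)
  map_add' p q := by
    funext i
    simp
  map_smul' a p := by
    funext i
    simp

theorem coordMap_injective (ζ : K ≃+* K) : Function.Injective (coordMap ζ) := by
  intro p q h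
  funext i
  exact ζ.injective (congrFun h i)

/-- The collineation `K(p₀,p₁,p₂,p₃)ᵀ ↦ K(ζ(p₀),ζ(p₁),ζ(p₂),ζ(p₃))ᵀ`. -/
def autCollineation (ζ : K ≃+* K) : Point K → Point K :=
  Projectivization.map (coordMap ζ) (coordMap_injective ζ)

theorem mulVecLin_injective (M : GL (Fin 4) K) :
    Function.Injective (Matrix.mulVecLin (M : Matrix (Fin 4) (Fin 4) K)) :=
  Matrix.mulVec_injective_of_isUnit M.isUnit

/-- The projective collineation `Kp ↦ K(M·p)` induced by an invertible matrix `M`. -/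
def matrixCollineation (M : GL (Fin 4) K) : Point K → Point K :=
  Projectivization.map (Matrix.mulVecLin (M : Matrix (Fin 4) (Fin 4) K)) (mulVecLin_injective M)

/-- A projective collineation is one which is induced by an invertible matrix. -/
def IsProjectiveCollineation (κ : Point K → Point K) : Prop :=
  ∃ M : GL (Fin 4) K, κ = matrixCollineation M

/-- The matrices `M_{a,b,c}`. -/
def cayleyMatrix (a b c : K) : Matrix (Fin 4) (Fin 4) K :=
  !![1, 0, 0, 0;
     a, c, 0, 0;
     b, 3 * a * c, c ^ 2, 0;
     a * b - a ^ 3, b * c, a * c ^ 2, c ^ 3]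

theorem cayleyMatrix_mul (a b c x y z : K) :
    cayleyMatrix a b c * cayleyMatrix x y z =
      cayleyMatrix (a + c * x) (b + 3 * a * c * x + c ^ 2 * y) (c * z) := by
  ext i j
  fin_cases i <;> fin_cases j <;>
    simp [cayleyMatrix, Matrix.mul_apply, Fin.sum_univ_four] <;> ring

theorem cayleyMatrix_one : cayleyMatrix (0 : K) 0 1 = 1 := by
  ext i j
  fin_cases i <;> fin_cases j <;> simp [cayleyMatrix]

variable (K)

/-- The group `G(F)` of all matrices `M_{a,b,c}` with `c ≠ 0`. -/
def cayleyGroup : Subgroup (GL (Fin 4) K) where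
  carrier := {M | ∃ a b c : K, c ≠ 0 ∧ (M : Matrix (Fin 4) (Fin 4) K) = cayleyMatrix a b c}
  mul_mem' := by
    rintro M N ⟨a, b, c, hc, hM⟩ ⟨x, y, z, hz, hN⟩
    exact ⟨_, _, _, mul_ne_zero hc hz, by
      rw [Units.val_mul, hM, hN, cayleyMatrix_mul]⟩
  one_mem' := ⟨0, 0, 1, one_ne_zero, by rw [Units.val_one, cayleyMatrix_one]⟩
  inv_mem' := by
    rintro M ⟨a, b, c, hc, hM⟩
    refine ⟨-a * c⁻¹, (3 * a ^ 2 - b) * (c⁻¹) ^ 2, c⁻¹, inv_ne_zero hc, ?_⟩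
    refine Units.inv_eq_of_mul_eq_one_right ?_
    rw [hM, cayleyMatrix_mul, ← cayleyMatrix_one]
    congr 1 <;> field_simp <;> ring

end

end CayleySurface

/-!
The proof has two ingredients.

The first is the fundamental theorem of projective geometry: every collineation of the
three-dimensional space is induced by a semilinear bijection, hence is a product of a matrix and a
field automorphism (`CayleySurface.IsCollineation.exists_eq_comp`). A collineation is represented by
a map `F` on vectors that preserves and reflects membership in spans (`IsCollineationLift`). Since
`F` respects the spans of arbitrary sets, it maps bases to bases and respects the coordinate
hyperplane `φ = 0`; on the complement it induces an affine map (`affinePart`). The parallelogram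
argument shows that this map is additive, and the effect of `F` on the lines through the origin
gives the accompanying field automorphism. Parallelism is expressed by the points at infinity rather
than by disjointness of lines, so that the field with two elements needs no separate treatment.

The second is the geometry of the lines on the surface. These are the double line `p₀ = p₁ = 0`
and the rulings, one for each `a` in `K` (`eq_doubleLine_or_ruling`). Distinct rulings are disjoint,
and each of them meets the double line. As there are at least two rulings, a projective collineation
that fixes the surface also fixes the double line (`map_doubleLine`), and so maps `Q₀` to a point
`K(1, a, b, ab - a³)ᵀ`.

The coordinatewise automorphism `ζ` fixes the surface because the cubic form has integral
coefficients. Thus if `κ = M ∘ ζ` fixes the surface, so does `M`. Some `A` in `G(F)` maps `Q₀` to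
`M Q₀` (`exists_cayleyGroup_apply_Q₀`), and `κ = A ∘ (A⁻¹ M) ∘ ζ` is the required factorization.
-/

open Submodule

/-! ### The fundamental theorem of projective geometry -/

/-- A map of vector spaces that represents a bijection of projective points preserving and
reflecting collinearity.  The condition `mem_span_pair_iff` also covers pairs that span only a
point, so that it contains well-definedness and injectivity on points. -/
structure IsCollineationLift {K V V' : Type*} [Field K] [AddCommGroup V] [Module K V]
    [AddCommGroup V'] [Module K V'] (F : V → V') : Prop where
  apply_zero : F 0 = 0
  mem_span_pair_iff : ∀ p q r : V, F r ∈ span K {F p, F q} ↔ r ∈ span K {p, q}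
  exists_smul_eq : ∀ w : V', ∃ (v : V) (c : K), c • F v = w

namespace IsCollineationLift

variable {K V V' : Type*} [Field K] [AddCommGroup V] [Module K V]
    [AddCommGroup V'] [Module K V'] {F : V → V'}

theorem mem_span_singleton_iff (hF : IsCollineationLift (K := K) F) (p r : V) :
    F r ∈ span K {F p} ↔ r ∈ span K {p} := by
  simpa using hF.mem_span_pair_iff p p r

theorem eq_zero_iff (hF : IsCollineationLift (K := K) F) {v : V} : F v = 0 ↔ v = 0 := by
  simpa [hF.apply_zero] using hF.mem_span_singleton_iff 0 v

theorem exists_map_add (hF : IsCollineationLift (K := K) F) (a b : K) (p q : V) :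
    ∃ c d : K, c • F p + d • F q = F (a • p + b • q) :=
  mem_span_pair.1 <| (hF.mem_span_pair_iff p q _).2 <| mem_span_pair.2 ⟨a, b, rfl⟩

/-- Collineations preserve and reflect the subspace spanned by any set of points. -/
theorem mem_span_image_iff (hF : IsCollineationLift (K := K) F) (S : Set V) (r : V) :
    F r ∈ span K (F '' S) ↔ r ∈ span K S := by
  constructor
  · intro h
    -- Every vector of the span of `F '' S` is a multiple of `F s` for some `s` in the span of `S`.
    have key : ∀ w ∈ span K (F '' S), ∃ s ∈ span K S, ∃ c : K, c • F s = w := by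
      intro w hw
      induction hw using span_induction with
      | mem w hw =>
        obtain ⟨s, hs, rfl⟩ := hw
        exact ⟨s, subset_span hs, 1, one_smul _ _⟩
      | zero => exact ⟨0, zero_mem _, 0, zero_smul _ _⟩
      | add w₁ w₂ _ _ h₁ h₂ =>
        obtain ⟨s, hs, a, rfl⟩ := h₁
        obtain ⟨t, ht, b, rfl⟩ := h₂
        obtain ⟨v, c, hv⟩ := hF.exists_smul_eq (a • F s + b • F t)
        by_cases hc : c = 0
        · exact ⟨0, zero_mem _, 0, by rw [← hv, hc, zero_smul, zero_smul]⟩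
        · refine ⟨v, ?_, c, hv⟩
          have hv' : F v ∈ span K {F s, F t} :=
            (smul_mem_iff _ hc).1 (hv ▸ mem_span_pair.2 ⟨a, b, rfl⟩)
          refine span_le.2 ?_ ((hF.mem_span_pair_iff s t v).1 hv')
          rintro x (rfl | rfl) <;> assumption
      | smul a w _ h =>
        obtain ⟨s, hs, c, rfl⟩ := h
        exact ⟨s, hs, a * c, mul_smul _ _ _⟩
    obtain ⟨s, hs, c, hc⟩ := key _ h
    have hr : r ∈ span K {s} :=
      (hF.mem_span_singleton_iff s r).1 (mem_span_singleton.2 ⟨c, hc⟩)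
    exact (span_singleton_le_iff_mem s _).2 hs hr
  · intro h
    induction h using span_induction with
    | mem s hs => exact subset_span ⟨s, hs, rfl⟩
    | zero => rw [hF.apply_zero]; exact zero_mem _
    | add p q _ _ hp hq =>
      obtain ⟨c, d, h⟩ := hF.exists_map_add 1 1 p q
      rw [one_smul, one_smul] at h
      exact h ▸ add_mem (smul_mem _ _ hp) (smul_mem _ _ hq)
    | smul a p _ hp =>
      have : F (a • p) ∈ span K {F p} :=
        (hF.mem_span_singleton_iff _ _).2 (mem_span_singleton.2 ⟨a, rfl⟩)
      exact (span_singleton_le_iff_mem _ _).2 hp this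

theorem linearIndependent (hF : IsCollineationLift (K := K) F) {ι : Type*} {v : ι → V}
    (hv : LinearIndependent K v) : LinearIndependent K (F ∘ v) := by
  rw [linearIndependent_iff_notMem_span] at hv ⊢
  intro i hi
  rw [Set.image_comp] at hi
  exact hv i ((hF.mem_span_image_iff _ _).1 hi)

end IsCollineationLift

/-- The representative of `F v` on which `φ'` takes the value `1`; the zero vector if `φ'`
vanishes at `F v`. -/
def affineRep {K V V' : Type*} [Field K] [AddCommGroup V']
    [Module K V'] (F : V → V') (φ' : V' →ₗ[K] K) (v : V) : V' :=
  (φ' (F v))⁻¹ • F v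

/-- The map induced by a collineation on the affine part `φ = 1`, with the point `e` taken as the
origin: its arguments are the vectors of the hyperplane `φ = 0`. -/
def affinePart {K V V' : Type*} [Field K] [AddCommGroup V] [AddCommGroup V']
    [Module K V'] (F : V → V') (φ' : V' →ₗ[K] K) (e u : V) : V' :=
  affineRep F φ' (e + u) - affineRep F φ' e

@[simp]
theorem affinePart_zero {K V V' : Type*} [Field K] [AddCommGroup V] [AddCommGroup V']
    [Module K V'] (F : V → V') (φ' : V' →ₗ[K] K) (e : V) :
    affinePart F φ' e 0 = 0 := by
  simp [affinePart]

theorem affineRep_add {K V V' : Type*} [Field K] [AddCommGroup V] [AddCommGroup V']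
    [Module K V'] (F : V → V') (φ' : V' →ₗ[K] K) (e u : V) :
    affineRep F φ' (e + u) = affineRep F φ' e + affinePart F φ' e u := by
  simp [affinePart]

namespace IsCollineationLift

variable {K V V' : Type*} [Field K] [AddCommGroup V] [Module K V]
    [AddCommGroup V'] [Module K V'] {F : V → V'} {φ : V →ₗ[K] K} {φ' : V' →ₗ[K] K} {e : V}

theorem apply_affineRep (hφ : ∀ v, φ' (F v) = 0 ↔ φ v = 0) {v : V} (hv : φ v ≠ 0) :
    φ' (affineRep F φ' v) = 1 := by
  have : φ' (F v) ≠ 0 := fun h => hv ((hφ v).1 h)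
  simp [affineRep, this]

theorem smul_affineRep (hφ : ∀ v, φ' (F v) = 0 ↔ φ v = 0) {v : V} (hv : φ v ≠ 0) :
    φ' (F v) • affineRep F φ' v = F v := by
  have : φ' (F v) ≠ 0 := fun h => hv ((hφ v).1 h)
  simp [affineRep, this]

theorem apply_affinePart (hφ : ∀ v, φ' (F v) = 0 ↔ φ v = 0) (he : φ e = 1) {u : V}
    (hu : φ u = 0) : φ' (affinePart F φ' e u) = 0 := by
  rw [affinePart, map_sub, apply_affineRep hφ (by simp [he, hu]),
    apply_affineRep hφ (by simp [he]), sub_self]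

/-- The affine map and the collineation agree on the points at infinity. -/
theorem exists_smul_affinePart (hF : IsCollineationLift (K := K) F)
    (hφ : ∀ v, φ' (F v) = 0 ↔ φ v = 0) (he : φ e = 1) {u : V} (hu : φ u = 0) :
    ∃ a : K, a ≠ 0 ∧ F u = a • affinePart F φ' e u := by
  by_cases hu0 : u = 0
  · exact ⟨1, one_ne_zero, by rw [hu0, affinePart_zero, smul_zero, hF.apply_zero]⟩
  obtain ⟨a, b, h⟩ := hF.exists_map_add 1 (-1) (e + u) e
  rw [show (1 : K) • (e + u) + (-1 : K) • e = u by module] at h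
  rw [← smul_affineRep hφ (v := e + u) (by simp [he, hu]),
    ← smul_affineRep hφ (v := e) (by simp [he]), smul_smul, smul_smul] at h
  set c := a * φ' (F (e + u))
  set d := b * φ' (F e)
  have h0 : c + d = 0 := by
    have := congrArg φ' h
    rwa [(hφ u).2 hu, map_add, map_smul, map_smul, apply_affineRep hφ (by simp [he, hu]),
      apply_affineRep hφ (by simp [he]), smul_eq_mul, smul_eq_mul, mul_one, mul_one] at this
  have hc : F u = c • affinePart F φ' e u := by
    rw [← h, affinePart, eq_neg_of_add_eq_zero_right h0]
    module
  refine ⟨c, ?_, hc⟩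
  intro h'
  rw [h', zero_smul, hF.eq_zero_iff] at hc
  exact hu0 hc

theorem affinePart_ne_zero (hF : IsCollineationLift (K := K) F)
    (hφ : ∀ v, φ' (F v) = 0 ↔ φ v = 0) (he : φ e = 1) {u : V} (hu : φ u = 0) (hu0 : u ≠ 0) :
    affinePart F φ' e u ≠ 0 := by
  obtain ⟨a, -, h⟩ := hF.exists_smul_affinePart hφ he hu
  intro h'
  rw [h', smul_zero, hF.eq_zero_iff] at h
  exact hu0 h

theorem affinePart_notMem_span (hF : IsCollineationLift (K := K) F)
    (hφ : ∀ v, φ' (F v) = 0 ↔ φ v = 0) (he : φ e = 1) {u v : V} (hu : φ u = 0) (hv : φ v = 0)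
    (h : v ∉ span K {u}) : affinePart F φ' e v ∉ span K {affinePart F φ' e u} := by
  obtain ⟨a, ha, hFu⟩ := hF.exists_smul_affinePart hφ he hu
  obtain ⟨b, hb, hFv⟩ := hF.exists_smul_affinePart hφ he hv
  intro h'
  apply h
  rw [← hF.mem_span_singleton_iff, hFu, hFv, span_singleton_smul_eq (IsUnit.mk0 a ha)]
  exact smul_mem _ _ h'

/-- A line in the direction of `v` is mapped into a line in the direction of the image of `v`. -/
theorem exists_affinePart_add_smul (hF : IsCollineationLift (K := K) F)
    (hφ : ∀ v, φ' (F v) = 0 ↔ φ v = 0) (he : φ e = 1) {u v : V} (hu : φ u = 0) (hv : φ v = 0)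
    (t : K) : ∃ s : K,
      affinePart F φ' e (u + t • v) = affinePart F φ' e u + s • affinePart F φ' e v := by
  obtain ⟨c, -, hc⟩ := hF.exists_smul_affinePart hφ he hv
  obtain ⟨a, b, h⟩ := hF.exists_map_add 1 t (e + u) v
  rw [show (1 : K) • (e + u) + t • v = e + (u + t • v) by module] at h
  have h1 : φ (e + (u + t • v)) ≠ 0 := by simp [he, hu, hv]
  have h2 : φ (e + u) ≠ 0 := by simp [he, hu]
  have hd : φ' (F (e + (u + t • v))) ≠ 0 := fun h => h1 ((hφ _).1 h)
  rw [← smul_affineRep hφ h2, hc, smul_smul, smul_smul] at h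
  have h3 := congrArg ((φ' (F (e + (u + t • v))))⁻¹ • ·) h
  change _ = affineRep F φ' _ at h3
  simp only [smul_add, smul_smul] at h3
  generalize (φ' (F (e + (u + t • v))))⁻¹ * (a * φ' (F (e + u))) = x at h3
  generalize (φ' (F (e + (u + t • v))))⁻¹ * (b * c) = y at h3
  have hx : x = 1 := by
    have := congrArg φ' h3
    rwa [map_add, map_smul, map_smul, apply_affineRep hφ h1, apply_affineRep hφ h2,
      apply_affinePart hφ he hv, smul_eq_mul, smul_zero, mul_one, add_zero] at this
  refine ⟨y, ?_⟩
  rw [affinePart, ← h3, hx, affinePart, affinePart]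
  module

/-- The parallelogram argument: `u + v` is the intersection of the parallels to `v` through `u`
and to `u` through `v`. -/
theorem affinePart_add_of_notMem_span (hF : IsCollineationLift (K := K) F)
    (hφ : ∀ v, φ' (F v) = 0 ↔ φ v = 0) (he : φ e = 1) {u v : V} (hu : φ u = 0) (hv : φ v = 0)
    (h : v ∉ span K {u}) :
    affinePart F φ' e (u + v) = affinePart F φ' e u + affinePart F φ' e v := by
  obtain ⟨s, hs⟩ := hF.exists_affinePart_add_smul hφ he hu hv 1
  obtain ⟨t, ht⟩ := hF.exists_affinePart_add_smul hφ he hv hu 1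
  rw [one_smul] at hs ht
  rw [add_comm v u, hs] at ht
  have hs1 : s = 1 := by
    by_contra hne
    have h1 : (s - 1) • affinePart F φ' e v = (t - 1) • affinePart F φ' e u := by
      linear_combination (norm := module) ht
    refine hF.affinePart_notMem_span hφ he hu hv h ?_
    rw [← smul_mem_iff _ (sub_ne_zero.2 hne), h1]
    exact smul_mem _ _ (mem_span_singleton_self _)
  rw [hs, hs1, one_smul]

theorem affinePart_add (hF : IsCollineationLift (K := K) F)
    (hφ : ∀ v, φ' (F v) = 0 ↔ φ v = 0) (he : φ e = 1)
    (hdim : ∀ u, φ u = 0 → ∃ w, φ w = 0 ∧ w ∉ span K {u}) {u v : V} (hu : φ u = 0)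
    (hv : φ v = 0) :
    affinePart F φ' e (u + v) = affinePart F φ' e u + affinePart F φ' e v := by
  by_cases hu0 : u = 0
  · simp [hu0, affinePart_zero]
  by_cases h : v ∈ span K {u}
  swap
  · exact hF.affinePart_add_of_notMem_span hφ he hu hv h
  -- For proportional vectors, both sides are compared after adding a vector outside their span.
  obtain ⟨w, hw, hwu⟩ := hdim u hu
  obtain ⟨a, rfl⟩ := mem_span_singleton.1 h
  have h1 : a • u + w ∉ span K {u} := fun h' =>
    hwu ((Submodule.add_mem_iff_right _ (smul_mem _ a (mem_span_singleton_self u))).1 h')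
  have hav : ∀ b : K, w ∉ span K {b • u} := fun b h' =>
    hwu (span_singleton_smul_le K b u h')
  have h2 := hF.affinePart_add_of_notMem_span hφ he hu (v := a • u + w) (by simp [hu, hw]) h1
  have h3 := hF.affinePart_add_of_notMem_span hφ he hv hw (hav a)
  have h4 := hF.affinePart_add_of_notMem_span hφ he (u := (1 + a) • u) (by simp [hu]) hw
    (hav _)
  rw [show (1 + a) • u = u + a • u by module] at h4
  rw [h3, ← add_assoc u, h4, ← add_assoc] at h2
  exact add_right_cancel h2

/-- All vectors of the hyperplane share the same scaling function `σ`, because independent vectors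
`u` and `v` share it with `u + v`. -/
theorem exists_affinePart_smul (hF : IsCollineationLift (K := K) F)
    (hφ : ∀ v, φ' (F v) = 0 ↔ φ v = 0) (he : φ e = 1)
    (hdim : ∀ u, φ u = 0 → ∃ w, φ w = 0 ∧ w ∉ span K {u}) :
    ∃ σ : K → K, ∀ u, φ u = 0 → ∀ t,
      affinePart F φ' e (t • u) = σ t • affinePart F φ' e u := by
  have hex : ∀ (u : V) (t : K), ∃ s : K, φ u = 0 →
      affinePart F φ' e (t • u) = s • affinePart F φ' e u := by
    intro u t
    by_cases hu : φ u = 0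
    · obtain ⟨s, hs⟩ := hF.exists_affinePart_add_smul hφ he (u := 0) φ.map_zero hu t
      exact ⟨s, fun _ => by simpa [affinePart_zero] using hs⟩
    · exact ⟨0, fun h => absurd h hu⟩
  choose s hs using hex
  have key : ∀ u v, φ u = 0 → φ v = 0 → u ≠ 0 → v ∉ span K {u} → ∀ t, s u t = s v t := by
    intro u v hu hv hu0 h t
    have h1 := hs (u + v) t (by simp [hu, hv])
    rw [smul_add, hF.affinePart_add hφ he hdim (by simp [hu]) (by simp [hv]),
      hF.affinePart_add hφ he hdim hu hv, hs u t hu, hs v t hv] at h1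
    set x := affinePart F φ' e u
    set y := affinePart F φ' e v
    have h2 : (s v t - s (u + v) t) • y = (s (u + v) t - s u t) • x := by
      linear_combination (norm := module) h1
    have h3 : s v t - s (u + v) t = 0 := by
      by_contra hne
      refine hF.affinePart_notMem_span hφ he hu hv h ?_
      rw [← smul_mem_iff _ hne, h2]
      exact smul_mem _ _ (mem_span_singleton_self _)
    rw [h3, zero_smul, eq_comm, smul_eq_zero_iff_left (hF.affinePart_ne_zero hφ he hu hu0)] at h2
    linear_combination -h2 - h3
  obtain ⟨u₀, hu₀, h0⟩ := hdim 0 φ.map_zero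
  have h0' : u₀ ≠ 0 := by
    rintro rfl
    exact h0 (zero_mem _)
  refine ⟨s u₀, fun u hu t => ?_⟩
  by_cases hz : u = 0
  · simp [hz, affinePart_zero]
  rw [hs u t hu]
  by_cases h : u ∈ span K {u₀}
  · obtain ⟨w, hw, hwu⟩ := hdim u₀ hu₀
    obtain ⟨c, rfl⟩ := mem_span_singleton.1 h
    rw [key u₀ w hu₀ hw h0' hwu t,
      key (c • u₀) w hu hw hz (fun h' => hwu (span_singleton_smul_le K c u₀ h')) t]
  · rw [key u₀ u hu₀ hu h0' h t]

/-- The fundamental theorem of projective geometry, for a collineation that maps the hyperplane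
`φ = 0` to the hyperplane `φ' = 0`: it is induced by a semilinear map. The hypothesis `hdim` says
that the hyperplane is at least two-dimensional. -/
theorem exists_semilinear (hF : IsCollineationLift (K := K) F)
    (hφ : ∀ v, φ' (F v) = 0 ↔ φ v = 0) (he : φ e = 1)
    (hdim : ∀ u, φ u = 0 → ∃ w, φ w = 0 ∧ w ∉ span K {u}) :
    ∃ (σ : K ≃+* K) (T : V →ₛₗ[(σ : K →+* K)] V'), ∀ v, ∃ c : K, c ≠ 0 ∧ F v = c • T v := by
  obtain ⟨σ, hσ⟩ := hF.exists_affinePart_smul hφ he hdim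
  obtain ⟨u, hu, hu0⟩ := hdim 0 φ.map_zero
  replace hu0 : u ≠ 0 := by
    rintro rfl
    exact hu0 (zero_mem _)
  have hgu := hF.affinePart_ne_zero hφ he hu hu0
  have hσ1 : σ 1 = 1 := by
    apply smul_left_injective K hgu
    simp only
    rw [← hσ u hu, one_smul, one_smul]
  have hσ0 : σ 0 = 0 := by
    apply smul_left_injective K hgu
    simp only
    rw [← hσ u hu, zero_smul, zero_smul, affinePart_zero]
  have hσmul : ∀ a b, σ (a * b) = σ a * σ b := by
    intro a b
    apply smul_left_injective K hgu
    simp only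
    rw [← hσ u hu, mul_smul, hσ _ (by simp [hu]), hσ u hu, mul_smul]
  have hσadd : ∀ a b, σ (a + b) = σ a + σ b := by
    intro a b
    apply smul_left_injective K hgu
    simp only
    rw [← hσ u hu, add_smul, hF.affinePart_add hφ he hdim (by simp [hu]) (by simp [hu]),
      hσ u hu, hσ u hu, add_smul]
  let τ : K →+* K :=
    { toFun := σ, map_one' := hσ1, map_zero' := hσ0, map_mul' := hσmul, map_add' := hσadd }
  have hτ : Function.Surjective τ := by
    intro s
    -- The preimage of the point with affine coordinate `s` on the line joining `e` and `u`.
    obtain ⟨r, c, hr⟩ := hF.exists_smul_eq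
      (affineRep F φ' e + s • affinePart F φ' e u)
    have h1 := congrArg φ' hr
    rw [map_add, map_smul, map_smul, apply_affinePart hφ he hu,
      apply_affineRep hφ (by simp [he]), smul_zero, add_zero, smul_eq_mul] at h1
    have hc : c ≠ 0 := left_ne_zero_of_mul_eq_one h1
    obtain ⟨a, ha, hFu⟩ := hF.exists_smul_affinePart hφ he hu
    have hmem : r ∈ span K {e, u} := by
      rw [← hF.mem_span_pair_iff, ← smul_mem_iff _ hc, hr]
      refine mem_span_pair.2 ⟨(φ' (F e))⁻¹, s * a⁻¹, ?_⟩
      rw [hFu, smul_smul, inv_mul_cancel_right₀ ha, affineRep]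
    obtain ⟨x, y, rfl⟩ := mem_span_pair.1 hmem
    have hx : x ≠ 0 := by
      rintro rfl
      rw [(hφ _).2 (by simp [hu]), mul_zero] at h1
      exact zero_ne_one h1
    have hlin : F (x • e + y • u) ∈ span K {F (e + (x⁻¹ * y) • u)} := by
      rw [hF.mem_span_singleton_iff, mem_span_singleton]
      exact ⟨x, by rw [smul_add, smul_smul, mul_inv_cancel_left₀ hx]⟩
    obtain ⟨d, hd⟩ := mem_span_singleton.1 hlin
    have hne : φ (e + (x⁻¹ * y) • u) ≠ 0 := by simp [he, hu]
    rw [← hd, ← smul_affineRep hφ hne, affineRep_add, hσ u hu, smul_smul, smul_smul] at hr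
    generalize c * d * _ = z at hr
    have hz : z = 1 := by
      have := congrArg φ' hr
      simpa [apply_affinePart hφ he hu, apply_affineRep hφ (v := e) (by simp [he])] using this
    refine ⟨x⁻¹ * y, ?_⟩
    rw [hz, one_smul] at hr
    exact smul_left_injective K hgu (add_left_cancel hr)
  refine ⟨RingEquiv.ofBijective τ ⟨τ.injective, hτ⟩,
    { toFun := fun v => σ (φ v) • affineRep F φ' e + affinePart F φ' e (v - φ v • e)
      map_add' := ?_
      map_smul' := ?_ }, ?_⟩
  · intro v w
    rw [map_add, hσadd, show v + w - (φ v + φ w) • e = (v - φ v • e) + (w - φ w • e) by module,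
      hF.affinePart_add hφ he hdim (by simp [he]) (by simp [he])]
    module
  · intro a v
    change _ = σ a • _
    rw [map_smul, smul_eq_mul, hσmul,
      show a • v - (a * φ v) • e = a • (v - φ v • e) by module, hσ _ (by simp [he])]
    module
  · intro v
    change ∃ c : K, c ≠ 0 ∧ F v = c • (_ + _)
    by_cases hv : φ v = 0
    · obtain ⟨a, ha, h⟩ := hF.exists_smul_affinePart hφ he hv
      exact ⟨a, ha, by simpa [hv, hσ0] using h⟩
    · set x := φ v
      -- Here `v = x • (e + w)` with `w` in the hyperplane.
      set w := x⁻¹ • (v - x • e)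
      have hw : φ w = 0 := by simp [w, x, he]
      have hvw : v = x • (e + w) := by
        simp only [w]
        rw [smul_add, smul_inv_smul₀ hv]
        module
      have hne : φ (e + w) ≠ 0 := by simp [he, hw]
      have hlin : F v ∈ span K {F (e + w)} := by
        rw [hF.mem_span_singleton_iff, mem_span_singleton]
        exact ⟨x, hvw.symm⟩
      obtain ⟨d, hd⟩ := mem_span_singleton.1 hlin
      have hσx : σ x ≠ 0 := (map_ne_zero τ).2 hv
      have hvx : v - x • e = x • w := (smul_inv_smul₀ hv _).symm
      have hT : σ x • affineRep F φ' e + affinePart F φ' e (v - x • e)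
          = σ x • affineRep F φ' (e + w) := by
        rw [hvx, hσ w hw, affineRep_add, smul_add]
      rw [hT]
      refine ⟨d * φ' (F (e + w)) * (σ x)⁻¹, ?_, ?_⟩
      · refine mul_ne_zero (mul_ne_zero ?_ fun h => hne ((hφ _).1 h)) (inv_ne_zero hσx)
        rintro rfl
        rw [zero_smul, eq_comm, hF.eq_zero_iff] at hd
        exact hv (by simp [x, hd])
      · rw [smul_smul, inv_mul_cancel_right₀ hσx, mul_smul, smul_affineRep hφ hne, hd]

end IsCollineationLift

namespace CayleySurface

/-! ### Collineations and semilinear maps -/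

variable {K : Type*} [Field K]

theorem finrank_span_pair_eq_two {V : Type*} [AddCommGroup V] [Module K V] {p q : V} (hp : p ≠ 0)
    (hq : q ∉ span K {p}) : Module.finrank K (span K {p, q}) = 2 := by
  have h : LinearIndependent K ![p, q] :=
    (LinearIndependent.pair_iff' hp).2 fun a ha => hq (mem_span_singleton.2 ⟨a, ha⟩)
  have := finrank_span_eq_card h
  rwa [Matrix.range_cons_cons_empty] at this

theorem rep_mem_iff_submodule_le (P : Point K) (W : Submodule K (Fin 4 → K)) :
    P.rep ∈ W ↔ P.submodule ≤ W := by
  rw [P.submodule_eq, span_singleton_le_iff_mem]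

open Classical in
/-- A map on vectors which represents the map `κ` on points. -/
noncomputable def vectorLift (κ : Point K → Point K) (v : Fin 4 → K) : Fin 4 → K :=
  if h : v = 0 then 0 else (κ (Projectivization.mk K v h)).rep

theorem vectorLift_of_ne_zero (κ : Point K → Point K) {v : Fin 4 → K} (h : v ≠ 0) :
    vectorLift κ v = (κ (Projectivization.mk K v h)).rep := dif_neg h

theorem vectorLift_ne_zero (κ : Point K → Point K) {v : Fin 4 → K} (h : v ≠ 0) :
    vectorLift κ v ≠ 0 := by
  rw [vectorLift_of_ne_zero κ h]
  exact Projectivization.rep_nonzero _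

theorem vectorLift_mem_span_singleton_iff {κ : Point K → Point K} (hκ : Function.Injective κ)
    (p r : Fin 4 → K) : vectorLift κ r ∈ span K {vectorLift κ p} ↔ r ∈ span K {p} := by
  by_cases hr : r = 0
  · simp [hr, vectorLift]
  by_cases hp : p = 0
  · simpa [hp, hr, vectorLift] using vectorLift_ne_zero κ hr
  have h := Projectivization.mk_eq_mk_iff' K _ _ (vectorLift_ne_zero κ hr) (vectorLift_ne_zero κ hp)
  rw [mem_span_singleton, ← h, mem_span_singleton, ← Projectivization.mk_eq_mk_iff' K _ _ hr hp,
    ← hκ.eq_iff (a := Projectivization.mk K r hr)]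
  simp_rw [vectorLift_of_ne_zero κ hr, vectorLift_of_ne_zero κ hp, Projectivization.mk_rep]

theorem IsCollineation.isCollineationLift {κ : Point K → Point K} (hκ : IsCollineation κ) :
    IsCollineationLift (K := K) (vectorLift κ) where
  apply_zero := dif_pos rfl
  mem_span_pair_iff p q r := by
    have hs := vectorLift_mem_span_singleton_iff hκ.1.1
    by_cases hp : p = 0
    · simpa [hp, vectorLift] using hs q r
    by_cases hq : q ∈ span K {p}
    · rw [Set.pair_comm p, Set.pair_comm (vectorLift κ p),
        span_insert_eq_span ((hs p q).2 hq), span_insert_eq_span hq, hs]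
    -- Now `p` and `q` span a line; its image is the line spanned by the images of `p` and `q`.
    obtain ⟨W, hW, hL⟩ := hκ.2 _ ⟨span K {p, q}, finrank_span_pair_eq_two hp hq, rfl⟩
    have hmem : ∀ x, vectorLift κ x ∈ W ↔ x ∈ span K {p, q} := by
      intro x
      by_cases hx : x = 0
      · simp [hx, vectorLift]
      rw [vectorLift_of_ne_zero κ hx, rep_mem_iff_submodule_le]
      have := hκ.1.1.mem_set_image (s := {P : Point K | P.submodule ≤ span K {p, q}})
        (a := Projectivization.mk K x hx)
      rw [hL] at this
      simpa [span_singleton_le_iff_mem] using this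
    have hspan : span K {vectorLift κ p, vectorLift κ q} = W := by
      apply eq_of_le_of_finrank_eq
      · rw [span_le]
        rintro x (rfl | rfl)
        · exact (hmem _).2 (subset_span (by simp))
        · exact (hmem _).2 (subset_span (by simp))
      · rw [hW, finrank_span_pair_eq_two (vectorLift_ne_zero κ hp)]
        rwa [hs]
    rw [hspan, hmem]
  exists_smul_eq w := by
    by_cases hw : w = 0
    · exact ⟨0, 0, by simp [hw]⟩
    obtain ⟨P, hP⟩ := hκ.1.2 (Projectivization.mk K w hw)
    obtain ⟨a, ha⟩ := Projectivization.exists_smul_eq_mk_rep K w hw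
    refine ⟨P.rep, (a⁻¹ : Kˣ), ?_⟩
    rw [vectorLift_of_ne_zero κ P.rep_nonzero, Projectivization.mk_rep, hP, ← ha]
    exact inv_smul_smul a w

/-- The fundamental theorem of projective geometry in dimension three. -/
theorem IsCollineation.exists_eq_comp {κ : Point K → Point K} (hκ : IsCollineation κ) :
    ∃ (M : GL (Fin 4) K) (ζ : K ≃+* K), κ = matrixCollineation M ∘ autCollineation ζ := by
  have hF := hκ.isCollineationLift
  set F := vectorLift κ
  let b := Pi.basisFun K (Fin 4)
  have hli := hF.linearIndependent b.linearIndependent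
  let b' := basisOfLinearIndependentOfCardEqFinrank hli (by simp)
  have hb' : ∀ i, b' i = F (b i) := fun i => by simp [b']
  -- The hyperplane `p₀ = 0` is mapped onto the span of the images of its three base points.
  have hφ : ∀ v, b'.coord 0 (F v) = 0 ↔ b.coord 0 v = 0 := by
    have hc : ∀ (B : Module.Basis (Fin 4) K (Fin 4 → K)) (v : Fin 4 → K),
        B.coord 0 v = 0 ↔ v ∈ span K (B '' {1, 2, 3}) := by
      intro B v
      rw [B.mem_span_image, Module.Basis.coord_apply]
      constructor
      · intro h i hi
        fin_cases i <;> simp_all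
      · intro h
        by_contra h0
        have := h (Finsupp.mem_support_iff.2 h0)
        simp at this
    intro v
    rw [hc, hc, ← hF.mem_span_image_iff _ v, ← Set.image_comp]
    have : (b' : Fin 4 → Fin 4 → K) = F ∘ b := funext hb'
    rw [this]
  have hdim : ∀ u, b.coord 0 u = 0 → ∃ w, b.coord 0 w = 0 ∧ w ∉ span K {u} := by
    intro u _
    by_contra! h
    have h1 := h (b 1) (by simp [b])
    have h2 := h (b 2) (by simp [b])
    obtain ⟨x, hx⟩ := mem_span_singleton.1 h1
    obtain ⟨y, hy⟩ := mem_span_singleton.1 h2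
    have e1 := congrFun hx 1
    have e2 := congrFun hx 2
    have e3 := congrFun hy 2
    simp [b] at e1 e2 e3
    rcases e2 with h | h <;> simp [h] at e1 e3
  obtain ⟨σ, T, hT⟩ := hF.exists_semilinear hφ (e := b 0) (by simp [b]) hdim
  let N : Matrix (Fin 4) (Fin 4) K := Matrix.of fun i j => T (b j) i
  have hTN : ∀ v, T v = N.mulVec (coordMap σ v) := by
    intro v
    conv_lhs => rw [← b.sum_repr v]
    ext i
    simp [N, Matrix.mulVec, dotProduct, coordMap, b, mul_comm]
  have hN : IsUnit N := by
    rw [← Matrix.mulVec_injective_iff_isUnit, ← Matrix.coe_mulVecLin,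
      injective_iff_map_eq_zero]
    intro w hw
    set v : Fin 4 → K := coordMap σ.symm w
    have hv : coordMap σ v = w := by
      ext i
      simp [v, coordMap]
    obtain ⟨c, -, h⟩ := hT v
    rw [hTN, hv, ← Matrix.mulVecLin_apply, hw, smul_zero, hF.eq_zero_iff] at h
    rw [← hv, h, map_zero]
  obtain ⟨M, hM⟩ := hN
  refine ⟨M, σ, funext fun P => ?_⟩
  induction P using Projectivization.ind with | h v hv => ?_
  obtain ⟨c, hc, h⟩ := hT v
  rw [← Projectivization.mk_rep (κ _)]
  simp only [Function.comp, autCollineation, matrixCollineation, Projectivization.map_mk]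
  rw [Projectivization.mk_eq_mk_iff']
  refine ⟨c, ?_⟩
  rw [← vectorLift_of_ne_zero κ hv, Matrix.mulVecLin_apply, hM, ← hTN]
  exact h.symm

theorem isCollineation_map {σ : K ≃+* K} (T : (Fin 4 → K) →ₛₗ[(σ : K →+* K)] (Fin 4 → K))
    (hT : Function.Bijective T) : IsCollineation (Projectivization.map T hT.1) := by
  have hinj : Function.Injective (Projectivization.map T hT.1) := by
    intro P Q h
    induction P using Projectivization.ind with | h v hv => ?_
    induction Q using Projectivization.ind with | h w hw => ?_
    rw [Projectivization.map_mk, Projectivization.map_mk, Projectivization.mk_eq_mk_iff'] at h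
    obtain ⟨a, ha⟩ := h
    rw [Projectivization.mk_eq_mk_iff']
    exact ⟨σ.symm a, hT.1 (by simp [ha])⟩
  have hsurj : Function.Surjective (Projectivization.map T hT.1) := by
    intro P
    induction P using Projectivization.ind with | h w hw => ?_
    obtain ⟨v, rfl⟩ := hT.2 w
    exact ⟨Projectivization.mk K v fun h => hw (by rw [h, map_zero]), rfl⟩
  refine ⟨⟨hinj, hsurj⟩, ?_⟩
  rintro _ ⟨W, hW, rfl⟩
  have : RingHomSurjective (σ : K →+* K) := ⟨σ.surjective⟩
  refine ⟨W.map T, ?_, ?_⟩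
  · let j : W ≃+ W.map T := AddEquiv.ofBijective
      ({ toFun := fun w => ⟨T w, mem_map_of_mem w.2⟩
         map_zero' := by simp
         map_add' := by simp } : W →+ W.map T)
      ⟨fun x y h => Subtype.ext (hT.1 (congrArg Subtype.val h)), by
        rintro ⟨_, w, hw, rfl⟩
        exact ⟨⟨w, hw⟩, rfl⟩⟩
    rw [← hW, Module.finrank, Module.finrank,
      rank_eq_of_equiv_equiv σ j σ.bijective fun r w => 
        Subtype.ext (T.map_smulₛₗ r (w : Fin 4 → K))]
  · ext P
    obtain ⟨Q, rfl⟩ := hsurj P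
    rw [hinj.mem_set_image]
    induction Q using Projectivization.ind with | h v hv => ?_
    simp only [Set.mem_ofPred_eq, Projectivization.map_mk, Projectivization.submodule_mk,
      span_singleton_le_iff_mem]
    exact ⟨fun h => mem_map_of_mem h, fun ⟨w, hw, h⟩ => hT.1 h ▸ hw⟩

theorem isCollineation_autCollineation (ζ : K ≃+* K) : IsCollineation (autCollineation ζ) :=
  isCollineation_map (coordMap ζ) ⟨coordMap_injective ζ, fun w =>
    ⟨coordMap ζ.symm w, by ext i; simp [coordMap]⟩⟩

theorem mulVecLin_bijective (M : GL (Fin 4) K) :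
    Function.Bijective (Matrix.mulVecLin (M : Matrix (Fin 4) (Fin 4) K)) :=
  ⟨mulVecLin_injective M, Matrix.mulVec_surjective_iff_isUnit.2 M.isUnit⟩

theorem isCollineation_matrixCollineation (M : GL (Fin 4) K) :
    IsCollineation (matrixCollineation M) :=
  isCollineation_map (σ := RingEquiv.refl K) _ (mulVecLin_bijective M)

theorem IsCollineation.comp {κ κ' : Point K → Point K} (h : IsCollineation κ)
    (h' : IsCollineation κ') : IsCollineation (κ ∘ κ') :=
  ⟨h.1.comp h'.1, fun L hL => by rw [Set.image_comp]; exact h.2 _ (h'.2 _ hL)⟩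

theorem matrixCollineation_mul (M N : GL (Fin 4) K) :
    matrixCollineation (M * N) = matrixCollineation M ∘ matrixCollineation N := by
  funext P
  induction P using Projectivization.ind with | h v hv => ?_
  simp [matrixCollineation, Projectivization.map_mk]

theorem matrixCollineation_one : matrixCollineation (1 : GL (Fin 4) K) = id := by
  funext P
  induction P using Projectivization.ind with | h v hv => ?_
  simp [matrixCollineation, Projectivization.map_mk]

/-! ### Automorphisms of the surface -/

theorem eval_cayleyForm (p : Fin 4 → K) : MvPolynomial.eval p (cayleyForm K) =
    p 0 * p 1 * p 2 - p 1 ^ 3 - p 0 ^ 2 * p 3 := by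
  simp [cayleyForm]

theorem mk_mem_cayleySurface_iff {v : Fin 4 → K} (hv : v ≠ 0) :
    Projectivization.mk K v hv ∈ cayleySurface K ↔
      v 0 * v 1 * v 2 - v 1 ^ 3 - v 0 ^ 2 * v 3 = 0 := by
  simp only [cayleySurface, zeroSet, Set.mem_ofPred_eq, Projectivization.submodule_mk,
    eval_cayleyForm]
  constructor
  · exact fun h => h v (mem_span_singleton_self v)
  · intro h p hp
    obtain ⟨c, rfl⟩ := mem_span_singleton.1 hp
    simp only [Pi.smul_apply, smul_eq_mul]
    linear_combination c ^ 3 * h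

theorem image_eq_of_mem_iff {α : Type*} {f : α → α} (hf : Function.Surjective f) {S : Set α}
    (h : ∀ x, f x ∈ S ↔ x ∈ S) : f '' S = S := by
  have : f ⁻¹' S = S := Set.ext h
  conv_lhs => rw [← this]
  exact Set.image_preimage_eq S hf

theorem autCollineation_image_cayleySurface (ζ : K ≃+* K) :
    autCollineation ζ '' cayleySurface K = cayleySurface K := by
  refine image_eq_of_mem_iff (isCollineation_autCollineation ζ).1.2 fun P => ?_
  induction P using Projectivization.ind with | h v hv => ?_
  rw [autCollineation, Projectivization.map_mk, mk_mem_cayleySurface_iff,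
    mk_mem_cayleySurface_iff, ← map_eq_zero_iff ζ ζ.injective (x := _ - _ - v 0 ^ 2 * _)]
  simp [coordMap]

theorem cayleyGroup_image_cayleySurface {M : GL (Fin 4) K} (hM : M ∈ cayleyGroup K) :
    matrixCollineation M '' cayleySurface K = cayleySurface K := by
  refine image_eq_of_mem_iff (isCollineation_matrixCollineation M).1.2 fun P => ?_
  obtain ⟨a, b, c, hc, hM⟩ := hM
  induction P using Projectivization.ind with | h v hv => ?_
  rw [matrixCollineation, Projectivization.map_mk, mk_mem_cayleySurface_iff,
    mk_mem_cayleySurface_iff, Matrix.mulVecLin_apply, hM]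
  -- The matrices of the group multiply the cubic form by the nonzero factor `c ^ 3`.
  rw [← mul_eq_zero_iff_left (pow_ne_zero 3 hc) (b := _ - _ - v 0 ^ 2 * _)]
  simp only [cayleyMatrix, Matrix.mulVec, dotProduct, Fin.sum_univ_four, Matrix.of_apply,
    Matrix.cons_val]
  ring_nf

/-! ### Lines on the surface -/

variable (K) in
/-- The subspace `p₀ = p₁ = 0`, which represents the double line of the surface. -/
def doubleLine : Submodule K (Fin 4 → K) := span K {![0, 0, 1, 0], ![0, 0, 0, 1]}

/-- The two-dimensional subspace which represents the ruling through the points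
`K(1, a, b, ab - a³)ᵀ`. -/
def ruling (a : K) : Submodule K (Fin 4 → K) := span K {![1, a, 0, -a ^ 3], ![0, 0, 1, a]}

theorem mem_doubleLine_iff {p : Fin 4 → K} : p ∈ doubleLine K ↔ p 0 = 0 ∧ p 1 = 0 := by
  rw [doubleLine, mem_span_pair]
  constructor
  · rintro ⟨x, y, rfl⟩
    simp
  · rintro ⟨h0, h1⟩
    refine ⟨p 2, p 3, ?_⟩
    ext i
    fin_cases i <;> simp [h0, h1]

theorem mem_ruling_iff {a : K} {p : Fin 4 → K} :
    p ∈ ruling a ↔ p 1 = a * p 0 ∧ p 3 = a * p 2 - a ^ 3 * p 0 := by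
  rw [ruling, mem_span_pair]
  constructor
  · rintro ⟨x, y, rfl⟩
    constructor <;> simp <;> ring
  · rintro ⟨h1, h3⟩
    refine ⟨p 0, p 2, ?_⟩
    ext i
    fin_cases i <;> simp [h1, h3] <;> ring

theorem finrank_doubleLine : Module.finrank K (doubleLine K) = 2 := by
  refine finrank_span_pair_eq_two (fun h => one_ne_zero (congrFun h 2)) fun h => ?_
  obtain ⟨c, hc⟩ := mem_span_singleton.1 h
  simpa using congrFun hc 3

theorem finrank_ruling (a : K) : Module.finrank K (ruling a) = 2 := by
  refine finrank_span_pair_eq_two (fun h => one_ne_zero (congrFun h 0)) fun h => ?_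
  obtain ⟨c, hc⟩ := mem_span_singleton.1 h
  have h0 := congrFun hc 0
  have h2 := congrFun hc 2
  simp at h0 h2

/-- The vectors on which the cubic form vanishes. -/
def cone (K : Type*) [Field K] : Set (Fin 4 → K) :=
  {p | p 0 * p 1 * p 2 - p 1 ^ 3 - p 0 ^ 2 * p 3 = 0}

theorem doubleLine_subset_cone : (doubleLine K : Set (Fin 4 → K)) ⊆ cone K := by
  intro p hp
  obtain ⟨h0, h1⟩ := mem_doubleLine_iff.1 hp
  simp [cone, h0, h1]

theorem ruling_subset_cone (a : K) : (ruling a : Set (Fin 4 → K)) ⊆ cone K := by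
  intro p hp
  obtain ⟨h1, h3⟩ := mem_ruling_iff.1 hp
  simp only [cone, Set.mem_ofPred_eq, h1, h3]
  ring

/-- The double line and the rulings are the only lines on the surface. -/
theorem eq_doubleLine_or_ruling {W : Submodule K (Fin 4 → K)} (hW : Module.finrank K W = 2)
    (h : (W : Set (Fin 4 → K)) ⊆ cone K) : W = doubleLine K ∨ ∃ a, W = ruling a := by
  have h01 : ∀ p ∈ W, p 0 = 0 → p 1 = 0 := by
    intro p hp h0
    have := h hp
    simpa [cone, h0] using this
  by_cases hle : W ≤ doubleLine K
  · exact Or.inl (eq_of_le_of_finrank_eq hle (hW.trans finrank_doubleLine.symm))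
  right
  obtain ⟨u, hu, hu0⟩ := SetLike.not_le_iff_exists.1 hle
  have hu0 : u 0 ≠ 0 := fun h0 => hu0 (mem_doubleLine_iff.2 ⟨h0, h01 u hu h0⟩)
  obtain ⟨w, hw, hw0⟩ : ∃ w ∈ W, w 0 = 1 :=
    ⟨(u 0)⁻¹ • u, W.smul_mem _ hu, by simp [hu0]⟩
  refine ⟨w 1, eq_of_le_of_finrank_eq ?_ (hW.trans (finrank_ruling _).symm)⟩
  intro p hp
  -- The difference `d` is the point at infinity of the line joining `w` and `p`.
  have hd : p - p 0 • w ∈ W := W.sub_mem hp (W.smul_mem _ hw)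
  have hd1 := h01 _ hd (by simp [hw0])
  have hc := h (W.add_mem hw hd)
  have hcw := h hw
  simp only [cone, Set.mem_ofPred_eq, Pi.add_apply, Pi.sub_apply, Pi.smul_apply, smul_eq_mul,
    hw0] at hd1 hc hcw
  have e1 : p 1 = w 1 * p 0 := by linear_combination hd1
  rw [mem_ruling_iff]
  refine ⟨e1, ?_⟩
  rw [e1] at hc
  linear_combination -hc + (1 - p 0) * hcw

theorem ruling_ne_doubleLine (a : K) : ruling a ≠ doubleLine K := by
  intro h
  have h1 : (![1, a, 0, -a ^ 3] : Fin 4 → K) ∈ doubleLine K :=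
    h ▸ subset_span (Set.mem_insert _ _)
  simpa using (mem_doubleLine_iff.1 h1).1

theorem eq_of_mem_ruling {a b : K} {p : Fin 4 → K} (hp : p ≠ 0) (ha : p ∈ ruling a)
    (hb : p ∈ ruling b) : a = b := by
  rw [mem_ruling_iff] at ha hb
  by_contra hne
  have hab : a - b ≠ 0 := sub_ne_zero.2 hne
  have h0 : p 0 = 0 := by
    refine (mul_eq_zero_iff_left hab).1 ?_
    linear_combination hb.1 - ha.1
  have h2 : p 2 = 0 := by
    refine (mul_eq_zero_iff_left hab).1 ?_
    linear_combination hb.2 - ha.2 + (a ^ 3 - b ^ 3) * h0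
  apply hp
  ext i
  fin_cases i
  · exact h0
  · simpa [h0] using ha.1
  · exact h2
  · simpa [h0, h2] using ha.2

/-- The double line is invariant, since it is the only line on the surface that meets two other
lines on the surface. -/
theorem map_doubleLine (T : (Fin 4 → K) →ₗ[K] (Fin 4 → K)) (hT : Function.Injective T)
    (hF : ∀ p ∈ cone K, T p ∈ cone K) : (doubleLine K).map T = doubleLine K := by
  have hmap : ∀ W : Submodule K (Fin 4 → K), Module.finrank K W = 2 →
      (W : Set (Fin 4 → K)) ⊆ cone K → W.map T = doubleLine K ∨ ∃ a, W.map T = ruling a := by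
    intro W hW hWF
    refine eq_doubleLine_or_ruling ?_ ?_
    · rw [← hW]
      exact (LinearEquiv.finrank_eq (Submodule.equivMapOfInjective T hT W)).symm
    · rintro _ ⟨p, hp, rfl⟩
      exact hF p (hWF hp)
  refine (hmap _ finrank_doubleLine doubleLine_subset_cone).resolve_right ?_
  rintro ⟨a, ha⟩
  -- If the image is a ruling, every ruling is mapped to the double line.
  have hr : ∀ b, (ruling b).map T = doubleLine K := by
    intro b
    refine (hmap _ (finrank_ruling b) (ruling_subset_cone b)).resolve_right ?_
    rintro ⟨c, hc⟩
    have hp : (![0, 0, 1, b] : Fin 4 → K) ≠ 0 := fun h => one_ne_zero (congrFun h 2)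
    have h1 : T ![0, 0, 1, b] ∈ ruling a := by
      rw [← ha]
      exact mem_map_of_mem (mem_doubleLine_iff.2 ⟨rfl, rfl⟩)
    have h2 : T ![0, 0, 1, b] ∈ ruling c := by
      rw [← hc]
      exact mem_map_of_mem (subset_span (by simp))
    have hac := eq_of_mem_ruling ((map_ne_zero_iff T hT).2 hp) h1 h2
    rw [← hac, ← ha] at hc
    exact ruling_ne_doubleLine b (map_injective_of_injective hT hc)
  have h01 := map_injective_of_injective hT ((hr 0).trans (hr 1).symm)
  have h1 : (![1, 1, 0, -1] : Fin 4 → K) ∈ ruling (0 : K) := by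
    rw [h01]
    exact mem_ruling_iff.2 (by simp)
  simpa using (mem_ruling_iff.1 h1).1

/-- The group `G(F)` is transitive on the points of the surface off the double line. -/
theorem exists_cayleyGroup_apply_Q₀ {v : Fin 4 → K} (hv : v ≠ 0)
    (hF : Projectivization.mk K v hv ∈ cayleySurface K) (hv0 : v ∉ doubleLine K) :
    ∃ A ∈ cayleyGroup K, matrixCollineation A (Q₀ K) = Projectivization.mk K v hv := by
  rw [mk_mem_cayleySurface_iff] at hF
  have h0 : v 0 ≠ 0 := by
    intro h0
    refine hv0 (mem_doubleLine_iff.2 ⟨h0, ?_⟩)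
    simpa [h0] using hF
  set a := v 1 / v 0
  set b := v 2 / v 0
  let A : GL (Fin 4) K :=
    { val := cayleyMatrix a b 1
      inv := cayleyMatrix (-a) (3 * a ^ 2 - b) 1
      val_inv := by
        rw [cayleyMatrix_mul, ← cayleyMatrix_one]
        congr 1 <;> ring
      inv_val := by
        rw [cayleyMatrix_mul, ← cayleyMatrix_one]
        congr 1 <;> ring }
  refine ⟨A, ⟨a, b, 1, one_ne_zero, rfl⟩, ?_⟩
  rw [Q₀, matrixCollineation, Projectivization.map_mk, Projectivization.mk_eq_mk_iff']
  refine ⟨(v 0)⁻¹, ?_⟩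
  have hA : (A : Matrix (Fin 4) (Fin 4) K) = cayleyMatrix a b 1 := rfl
  rw [Matrix.mulVecLin_apply, hA]
  ext i
  fin_cases i <;>
    simp [cayleyMatrix, Matrix.mulVec, dotProduct, Fin.sum_univ_four, h0, a, b]
  · field_simp
  · field_simp
  · field_simp
    linear_combination -hF

/-- A projective collineation fixing the surface maps `Q₀` to a point off the double line. -/
theorem mulVec_notMem_doubleLine {M : GL (Fin 4) K}
    (hM : matrixCollineation M '' cayleySurface K = cayleySurface K) :
    Matrix.mulVecLin (M : Matrix (Fin 4) (Fin 4) K) ![1, 0, 0, 0] ∉ doubleLine K := by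
  have hcone : ∀ p ∈ cone K, Matrix.mulVecLin (M : Matrix (Fin 4) (Fin 4) K) p ∈ cone K := by
    intro p hp
    by_cases hp0 : p = 0
    · rw [hp0, map_zero]
      simp [cone]
    exact (mk_mem_cayleySurface_iff _).1
      (hM ▸ Set.mem_image_of_mem (matrixCollineation M) ((mk_mem_cayleySurface_iff hp0).2 hp))
  rw [← map_doubleLine _ (mulVecLin_injective M) hcone]
  rintro ⟨p, hp, h⟩
  rw [mulVecLin_injective M h] at hp
  simpa using (mem_doubleLine_iff.1 hp).1

end CayleySurface

theorem mainTheorem6 {K : Type*} [Field K]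
    (κ : CayleySurface.Point K → CayleySurface.Point K) :
    (CayleySurface.IsCollineation κ ∧
        κ '' CayleySurface.cayleySurface K = CayleySurface.cayleySurface K) ↔
      ∃ κ₁ κ₂ κ₃ : CayleySurface.Point K → CayleySurface.Point K,
        (∃ ζ : K ≃+* K, κ₁ = CayleySurface.autCollineation ζ) ∧
        (CayleySurface.IsProjectiveCollineation κ₂ ∧
          κ₂ '' CayleySurface.cayleySurface K = CayleySurface.cayleySurface K ∧
          κ₂ (CayleySurface.Q₀ K) = CayleySurface.Q₀ K) ∧
        (∃ M ∈ CayleySurface.cayleyGroup K, κ₃ = CayleySurface.matrixCollineation M) ∧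
        κ = κ₃ ∘ κ₂ ∘ κ₁ := by
  open CayleySurface in
  constructor
  · rintro ⟨hκ, hF⟩
    obtain ⟨M, ζ, rfl⟩ := hκ.exists_eq_comp
    rw [Set.image_comp, autCollineation_image_cayleySurface] at hF
    have hQ : Q₀ K ∈ cayleySurface K := by
      rw [Q₀, mk_mem_cayleySurface_iff]
      simp
    obtain ⟨A, hA, hAQ⟩ := exists_cayleyGroup_apply_Q₀ _
      (hF ▸ Set.mem_image_of_mem (matrixCollineation M) hQ) (mulVec_notMem_doubleLine hF)
    have hinv : matrixCollineation A⁻¹ ∘ matrixCollineation A = id := by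
      rw [← matrixCollineation_mul, inv_mul_cancel, matrixCollineation_one]
    refine ⟨autCollineation ζ, matrixCollineation (A⁻¹ * M), matrixCollineation A, ⟨ζ, rfl⟩,
      ⟨⟨_, rfl⟩, ?_, ?_⟩, ⟨A, hA, rfl⟩, ?_⟩
    · rw [matrixCollineation_mul, Set.image_comp, hF,
        cayleyGroup_image_cayleySurface (inv_mem hA)]
    · rw [matrixCollineation_mul]
      change matrixCollineation A⁻¹ (matrixCollineation M (Q₀ K)) = _
      exact (congrArg _ hAQ.symm).trans (congrFun hinv _)
    · rw [← Function.comp_assoc, ← matrixCollineation_mul, mul_inv_cancel_left]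
  · rintro ⟨_, κ₂, _, ⟨ζ, rfl⟩, ⟨⟨N, rfl⟩, hN, -⟩, ⟨M, hM, rfl⟩, rfl⟩
    refine ⟨(isCollineation_matrixCollineation M).comp
      ((isCollineation_matrixCollineation N).comp (isCollineation_autCollineation ζ)), ?_⟩
    rw [Set.image_comp, Set.image_comp, autCollineation_image_cayleySurface, hN,
      cayleyGroup_image_cayleySurface hM]
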